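/- There is an absolute constant $K$ such that the following holds. Let $k \ge 1$ and $d \ge 0$ be integers, let $Z_1,\dots,Z_k,\mu \in \mathbb{R}^d$ and $r > 0$, and suppose that $\mu$ is certifiably $(r,1/10)$-central with respect to $Z_1,\dots,Z_k$. Then for all reals $c, C > 0$ and $\gamma \in \mathbb{R}$, every degree-$8$ pseudoexpectation $\tilde{\mathbb{E}}$ satisfying the polynomial system $\mathcal{A}(Z_1,\dots,Z_k,r,C,c,\gamma)$ has $$\tilde{\mathbb{E}}\,\|x-\mu\|^2 \le K r^2 .$$ The notions used are the following. *Certifiable centrality.* A point $y\in\mathbb{R}^d$ is certifiably $(r,p)$-central with respect to $Z_1,\dots,Z_k$ if the semidefinite program $$\max\ \frac1k\sum_{i=1}^k b_i \quad\text{over}\quad \begin{pmatrix}1 & b^\top & u^\top\\ b & B & W\\ u & W^\top & U\end{pmatrix}\succeq 0,\quad b\in\mathbb{R}^k,\ u\in\mathbb{R}^d,\ B\in\mathbb{R}^{k\times k},\ W\in\mathbb{R}^{k\times d},\ U\in\mathbb{R}^{d\times d},$$ subject to $B_{ii}\le 1$ for all $i\le k$, $\operatorname{Tr}U\le 1$,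 and $\langle Z_i-y,W_i\rangle\ge r\,b_i$ for all $i \le k$ ($W_i$ being the $i$-th row of $W$), has value at most $p$. *The system.* Let $T$ be the largest integer with $T \le \log_2(C/c)+1$ (and $T=0$ if that integer is negative). The indeterminates of $\mathcal{A}(Z_1,\dots,Z_k,r,C,c,\gamma)$ are $\alpha_i,\beta_i$ ($1\le i\le k$), $\sigma_{ij}$ ($1\le i,j\le d+k+1$), $x_1,\dots,x_d$, and $a_{i,t}$ ($1\le i\le k$, $0\le t\le T$). Its constraints are: 1. the polynomial equations stating that the identity $$\frac{k}{10}-\sum_{i=1}^k b_i=\sum_{i=1}^k\alpha_i b_i(\langle Z_i-x,v\rangle-r)+\sum_{i=1}^k\beta_i(1-b_i^2)+\gamma(1-\|v\|^2)+\sum_{i=1}^{d+k+1}\langle\sigma_i,(1,b,v)\rangle^2$$ holds coefficient by coefficient in the variables $b_1,\dots,b_k,v_1,\dots,v_d$, where $\sigma_i=(\sigma_{ij})_j$; 2. $\alpha_i\ge 0$ and $\beta_i\ge 0$ for all $i$; 3. for all $i$: $a_{i,t}^2=a_{i,t}$ for $0 \le t\le T$; $a_{i,t}2^{t-1}c\le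 a_{i,t}\alpha_i\le a_{i,t}2^t c$ for $1\le t\le T$ (two inequalities); $a_{i,0}\alpha_i=0$; $\sum_{t=0}^T a_{i,t}=1$; and $a_{i,t}a_{i,t'}=0$ for $t\ne t'$. *Pseudoexpectations.* A degree-$n$ pseudoexpectation is a linear functional $\tilde{\mathbb{E}}$ on the real polynomials of degree at most $n$ in the indeterminates, with $\tilde{\mathbb{E}}\,1=1$ and $\tilde{\mathbb{E}}\,q^2\ge 0$ whenever $\deg q\le n/2$. It satisfies an equation $p=0$ if $\tilde{\mathbb{E}}\,pq=0$ for every polynomial $q$ with $\deg(pq)\le n$, and an inequality $p\ge 0$ if $\tilde{\mathbb{E}}\,pq^2\ge 0$ for every polynomial $q$ with $\deg(pq^2)\le n$; it satisfies a system if it satisfies every equation and inequality in it. -/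

import Mathlib

noncomputable section

/-! ### The centrality SDP and certifiable centrality -/

/-- Index set of the coordinates of `(1, b, v)` with `b ∈ ℝᵏ` and `v ∈ ℝᵈ`. -/
abbrev BlockIdx (k d : ℕ) : Type := Unit ⊕ (Fin k ⊕ Fin d)

/-- The position of the leading entry `1`. -/
abbrev BlockIdx.one {k d : ℕ} : BlockIdx k d := Sum.inl ()

/-- The position of `b_i`. -/
abbrev BlockIdx.b {k d : ℕ} (i : Fin k) : BlockIdx k d := Sum.inr (Sum.inl i)

/-- The position of the `j`-th coordinate of the direction. -/
abbrev BlockIdx.u {k d : ℕ} (j : Fin d) : BlockIdx k d := Sum.inr (Sum.inr j)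

/-- `Y` is a feasible solution of the centrality SDP with parameters `Z_1, …, Z_k, x, r`:
`Y` is a symmetric positive semidefinite block matrix
`((1, bᵀ, uᵀ), (b, B, W), (u, Wᵀ, U))` with `B_ii ≤ 1`, `Tr U ≤ 1` and
`⟨Z_i - x, W_i⟩ ≥ r b_i`, where `W_i` is the `i`-th row of `W`. -/
structure CentralityFeasible {k d : ℕ} (Z : Fin k → EuclideanSpace ℝ (Fin d))
    (x : EuclideanSpace ℝ (Fin d)) (r : ℝ)
    (Y : Matrix (BlockIdx k d) (BlockIdx k d) ℝ) : Prop where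
  posSemidef : Y.PosSemidef
  corner : Y BlockIdx.one BlockIdx.one = 1
  diag_le : ∀ i : Fin k, Y (BlockIdx.b i) (BlockIdx.b i) ≤ 1
  trace_le : ∑ j : Fin d, Y (BlockIdx.u j) (BlockIdx.u j) ≤ 1
  shift : ∀ i : Fin k,
    r * Y BlockIdx.one (BlockIdx.b i)
      ≤ ∑ j : Fin d, (Z i j - x j) * Y (BlockIdx.b i) (BlockIdx.u j)

/-- The objective `(1/k) ∑ b_i` of the centrality SDP. -/
def centralityObjective {k d : ℕ} (Y : Matrix (BlockIdx k d) (BlockIdx k d) ℝ) : ℝ :=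
  (1 / (k : ℝ)) * ∑ i : Fin k, Y BlockIdx.one (BlockIdx.b i)

/-- The set of objective values of feasible solutions of the centrality SDP. -/
def centralityValues {k d : ℕ} (Z : Fin k → EuclideanSpace ℝ (Fin d))
    (x : EuclideanSpace ℝ (Fin d)) (r : ℝ) : Set ℝ :=
  {s | ∃ Y : Matrix (BlockIdx k d) (BlockIdx k d) ℝ,
    CentralityFeasible Z x r Y ∧ s = centralityObjective Y}

/-- The value of the centrality SDP. The supremum is over a nonempty bounded set, see
`centralityValues_nonempty` and `centralityValues_bddAbove`. -/
def centralityValue {k d : ℕ} (Z : Fin k → EuclideanSpace ℝ (Fin d))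
    (x : EuclideanSpace ℝ (Fin d)) (r : ℝ) : ℝ :=
  sSup (centralityValues Z x r)

theorem centralityValues_nonempty {k d : ℕ} (Z : Fin k → EuclideanSpace ℝ (Fin d))
    (x : EuclideanSpace ℝ (Fin d)) (r : ℝ) : (centralityValues Z x r).Nonempty := by
  refine ⟨_, Matrix.diagonal (Sum.elim (fun _ => (1 : ℝ)) (fun _ => 0)), ?_, rfl⟩
  refine ⟨Matrix.PosSemidef.diagonal ?_, ?_, ?_, ?_, ?_⟩
  · rintro (_ | _) <;> simp
  all_goals simp [Matrix.diagonal]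

theorem centralityValues_bddAbove {k d : ℕ} (Z : Fin k → EuclideanSpace ℝ (Fin d))
    (x : EuclideanSpace ℝ (Fin d)) (r : ℝ) : BddAbove (centralityValues Z x r) := by
  refine ⟨(1 / (k : ℝ)) * ∑ _i : Fin k, (1 : ℝ), ?_⟩
  rintro s ⟨Y, hY, rfl⟩
  unfold centralityObjective
  refine mul_le_mul_of_nonneg_left (Finset.sum_le_sum fun i _ => ?_) (by positivity)
  have h := (hY.posSemidef.submatrix ![BlockIdx.one, BlockIdx.b i]).dotProduct_mulVec_nonneg
    ![1, -1]
  have hs : Y (BlockIdx.b i) BlockIdx.one = Y BlockIdx.one (BlockIdx.b i) := by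
    simpa using hY.posSemidef.isHermitian.apply BlockIdx.one (BlockIdx.b i)
  have h1 := hY.corner
  have h2 := hY.diag_le i
  simp [Matrix.mulVec, dotProduct, Fin.sum_univ_two] at h
  simp only [BlockIdx.one, BlockIdx.b] at *
  linarith

/-- `x` is certifiably `(r, p)`-central with respect to `Z_1, …, Z_k`: the value of the
centrality SDP is at most `p`. -/
def CertifiablyCentral {k d : ℕ} (Z : Fin k → EuclideanSpace ℝ (Fin d))
    (r p : ℝ) (x : EuclideanSpace ℝ (Fin d)) : Prop :=
  centralityValue Z x r ≤ p

/-! ### Pseudoexpectations -/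

/-- A degree-`n` pseudoexpectation in the variables `V`: a linear functional on the real
polynomials of (total) degree at most `n` which is normalized and nonnegative on squares of
polynomials of degree at most `n / 2`. -/
structure PseudoExpectation (V : Type) (n : ℕ) where
  toLinearMap : MvPolynomial.restrictTotalDegree V ℝ n →ₗ[ℝ] ℝ
  map_one : ∀ p : MvPolynomial.restrictTotalDegree V ℝ n,
    (p : MvPolynomial V ℝ) = 1 → toLinearMap p = 1
  map_sq_nonneg : ∀ (q : MvPolynomial V ℝ) (p : MvPolynomial.restrictTotalDegree V ℝ n),
    2 * q.totalDegree ≤ n → (p : MvPolynomial V ℝ) = q ^ 2 → 0 ≤ toLinearMap p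

/-- A system of polynomial equations `p = 0` (`p ∈ eqs`) and inequalities `p ≥ 0`
(`p ∈ ineqs`). -/
structure PolySystem (V : Type) where
  eqs : Set (MvPolynomial V ℝ)
  ineqs : Set (MvPolynomial V ℝ)

/-- The pseudoexpectation satisfies `p = 0`. -/
def PseudoExpectation.SatisfiesEq {V : Type} {n : ℕ} (E : PseudoExpectation V n)
    (p : MvPolynomial V ℝ) : Prop :=
  ∀ (q : MvPolynomial V ℝ) (h : p * q ∈ MvPolynomial.restrictTotalDegree V ℝ n),
    E.toLinearMap ⟨p * q, h⟩ = 0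

/-- The pseudoexpectation satisfies `p ≥ 0`. -/
def PseudoExpectation.SatisfiesIneq {V : Type} {n : ℕ} (E : PseudoExpectation V n)
    (p : MvPolynomial V ℝ) : Prop :=
  ∀ (q : MvPolynomial V ℝ) (h : p * q ^ 2 ∈ MvPolynomial.restrictTotalDegree V ℝ n),
    0 ≤ E.toLinearMap ⟨p * q ^ 2, h⟩

/-- The pseudoexpectation satisfies every equation and inequality of the system. -/
def PseudoExpectation.Satisfies {V : Type} {n : ℕ} (E : PseudoExpectation V n)
    (A : PolySystem V) : Prop :=
  (∀ p ∈ A.eqs, E.SatisfiesEq p) ∧ (∀ p ∈ A.ineqs, E.SatisfiesIneq p)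

/-! ### The polynomial system `𝒜(Z_1, …, Z_k, r, C, c, γ)` -/

/-- The number of levels `t ≥ 1`, i.e. the largest integer `t ≤ log₂ (C / c) + 1`
(and `0` if there is no such `t ≥ 1`). -/
def numLevels (C c : ℝ) : ℕ := ⌊Real.logb 2 (C / c) + 1⌋₊

/-- The indeterminates of the system: `α_i`, `β_i`, `σ_ij`, `x_j` and `a_{i,t}` with
`0 ≤ t ≤ T`. -/
inductive MedianVar (k d T : ℕ) : Type
  | alpha (i : Fin k)
  | beta (i : Fin k)
  | sigma (i j : BlockIdx k d)
  | x (j : Fin d)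
  | a (i : Fin k) (t : Fin (T + 1))

namespace MedianVar

variable {k d T : ℕ}

/-- The indeterminate `α_i` as a polynomial. -/
abbrev pAlpha (i : Fin k) : MvPolynomial (MedianVar k d T) ℝ := MvPolynomial.X (alpha i)

/-- The indeterminate `β_i` as a polynomial. -/
abbrev pBeta (i : Fin k) : MvPolynomial (MedianVar k d T) ℝ := MvPolynomial.X (beta i)

/-- The indeterminate `σ_ij` as a polynomial. -/
abbrev pSigma (i j : BlockIdx k d) : MvPolynomial (MedianVar k d T) ℝ :=
  MvPolynomial.X (sigma i j)

/-- The indeterminate `x_j` as a polynomial. -/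
abbrev pX (j : Fin d) : MvPolynomial (MedianVar k d T) ℝ := MvPolynomial.X (x j)

/-- The indeterminate `a_{i,t}` as a polynomial. -/
abbrev pA (i : Fin k) (t : Fin (T + 1)) : MvPolynomial (MedianVar k d T) ℝ :=
  MvPolynomial.X (a i t)

end MedianVar

open MedianVar in
/-- Left side minus right side of the certificate identity
`k/10 - ∑ b_i = ∑ α_i b_i (⟨Z_i - x, v⟩ - r) + ∑ β_i (1 - b_i²) + γ (1 - ‖v‖²)
  + ∑_i ⟨σ_i, (1, b, v)⟩²`,
as a polynomial in the variables `b_1, …, b_k, v_1, …, v_d` whose coefficients are polynomials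
in the indeterminates of the system. -/
def certificatePoly {k d : ℕ} (T : ℕ) (Z : Fin k → EuclideanSpace ℝ (Fin d)) (r γ : ℝ) :
    MvPolynomial (Fin k ⊕ Fin d) (MvPolynomial (MedianVar k d T) ℝ) :=
  let K : MvPolynomial (MedianVar k d T) ℝ →
      MvPolynomial (Fin k ⊕ Fin d) (MvPolynomial (MedianVar k d T) ℝ) := MvPolynomial.C
  let R : ℝ → MvPolynomial (Fin k ⊕ Fin d) (MvPolynomial (MedianVar k d T) ℝ) :=
    fun s => MvPolynomial.C (MvPolynomial.C s)
  let b : Fin k → MvPolynomial (Fin k ⊕ Fin d) (MvPolynomial (MedianVar k d T) ℝ) :=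
    fun i => MvPolynomial.X (Sum.inl i)
  let v : Fin d → MvPolynomial (Fin k ⊕ Fin d) (MvPolynomial (MedianVar k d T) ℝ) :=
    fun j => MvPolynomial.X (Sum.inr j)
  let w : BlockIdx k d → MvPolynomial (Fin k ⊕ Fin d) (MvPolynomial (MedianVar k d T) ℝ) :=
    Sum.elim (fun _ => 1) (Sum.elim b v)
  (R ((k : ℝ) / 10) - ∑ i, b i) -
    (∑ i, K (pAlpha i) * b i * (∑ j, (R (Z i j) - K (pX j)) * v j - R r)
      + ∑ i, K (pBeta i) * (1 - b i ^ 2)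
      + R γ * (1 - ∑ j, v j ^ 2)
      + ∑ i : BlockIdx k d, (∑ j : BlockIdx k d, K (pSigma i j) * w j) ^ 2)

open MedianVar in
/-- The polynomial system `𝒜(Z_1, …, Z_k, r, C, c, γ)`. -/
def medianSystem {k d : ℕ} (Z : Fin k → EuclideanSpace ℝ (Fin d)) (r C c γ : ℝ) :
    PolySystem (MedianVar k d (numLevels C c)) where
  eqs :=
    -- the certificate identity holds coefficientwise
    {p | ∃ m : (Fin k ⊕ Fin d) →₀ ℕ,
      p = MvPolynomial.coeff m (certificatePoly (numLevels C c) Z r γ)}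
    -- `a_{i,t}² = a_{i,t}`
    ∪ {p | ∃ (i : Fin k) (t : Fin (numLevels C c + 1)), p = pA i t ^ 2 - pA i t}
    -- `a_{i,0} α_i = 0`
    ∪ {p | ∃ i : Fin k, p = pA i 0 * pAlpha i}
    -- `∑_t a_{i,t} = 1`
    ∪ {p | ∃ i : Fin k, p = ∑ t : Fin (numLevels C c + 1), pA i t - 1}
    -- `a_{i,t} a_{i,t'} = 0` for `t ≠ t'`
    ∪ {p | ∃ (i : Fin k) (t t' : Fin (numLevels C c + 1)), t ≠ t' ∧ p = pA i t * pA i t'}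
  ineqs :=
    -- `α_i ≥ 0` and `β_i ≥ 0`
    {p | ∃ i : Fin k, p = pAlpha i}
    ∪ {p | ∃ i : Fin k, p = pBeta i}
    -- `a_{i,t} 2^(t-1) c ≤ a_{i,t} α_i` for `t = s + 1 ≥ 1`
    ∪ {p | ∃ (i : Fin k) (s : Fin (numLevels C c)),
        p = pA i s.succ * pAlpha i - pA i s.succ * MvPolynomial.C (2 ^ (s : ℕ) * c)}
    -- `a_{i,t} α_i ≤ a_{i,t} 2^t c` for `t = s + 1 ≥ 1`
    ∪ {p | ∃ (i : Fin k) (s : Fin (numLevels C c)),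
        p = pA i s.succ * MvPolynomial.C (2 ^ ((s : ℕ) + 1) * c) - pA i s.succ * pAlpha i}

/-- The polynomial `‖x - μ‖²` in the indeterminates `x_1, …, x_d`. -/
def sqDistPoly {k d T : ℕ} (μ : EuclideanSpace ℝ (Fin d)) :
    MvPolynomial (MedianVar k d T) ℝ :=
  ∑ j : Fin d, (MedianVar.pX j - MvPolynomial.C (μ j)) ^ 2

theorem sqDistPoly_mem {k d T : ℕ} (μ : EuclideanSpace ℝ (Fin d)) :
    (sqDistPoly μ : MvPolynomial (MedianVar k d T) ℝ) ∈
      MvPolynomial.restrictTotalDegree (MedianVar k d T) ℝ 8 := by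
  rw [MvPolynomial.mem_restrictTotalDegree]
  refine (MvPolynomial.totalDegree_finsetSum_le (d := 2) fun j _ => ?_).trans (by norm_num)
  refine (MvPolynomial.totalDegree_pow _ _).trans ?_
  have h := MvPolynomial.totalDegree_sub_C_le
    (MedianVar.pX j : MvPolynomial (MedianVar k d T) ℝ) (μ j)
  rw [MvPolynomial.totalDegree_X] at h
  omega

/-- The pseudo-expected squared distance `𝔼̃ ‖x - μ‖²`. -/
def PseudoExpectation.sqDist {k d T : ℕ} (E : PseudoExpectation (MedianVar k d T) 8)
    (μ : EuclideanSpace ℝ (Fin d)) : ℝ :=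
  E.toLinearMap ⟨sqDistPoly μ, sqDistPoly_mem μ⟩

end

/-!
Conic duality for the centrality SDP turns centrality of `μ` into multipliers `α'`, `β'`, `γ'`
certifying the bound `p` for the point `μ`, just as the system certifies the bound `1 / 10` for
the point `x`. The two certificates are played against each other: the one for `x` is evaluated at
the direction `-w` and at `b_i = min 1 (α'_i / α_i)`, the one for `μ` at `w` and at
`b_i = min 1 (α_i / α'_i)`. Both choices give the shift terms the common weight
`α_i min 1 (α'_i / α_i)`, so the points `Z_i` cancel and only `⟨x - μ, w⟩ - 2 r` remains. In each
pair one of the two numbers `b_i` equals `1`, so the objectives exceed what the certificates allow.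
The numbers `b_i` are not polynomials in `α_i`, but replacing `α_i` in the denominators by the upper
end of its dyadic level makes them so, at the cost of a factor of `2` in this last step: the
objectives sum to at least `k / 2`, against the certified `(1 / 10 + p) k`, and the gap is
`(2 / 5 - p) k`.

Taking `w = 0` and multiplying by `‖x - μ‖ ^ 2` bounds the pseudo-expected weighted squared
distance from below by a multiple of `‖x - μ‖ ^ 2`; taking `w` proportional to `x - μ` bounds it
from above by a constant, because the multipliers `α_i` have total weight at most `11 k / (10 r)`.
-/

theorem nonpos_of_forall_mul_le {a u : ℝ} (h : ∀ t, 0 ≤ t → t * a ≤ u) : a ≤ 0 := by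
  by_contra! ha
  have hu : 0 ≤ u := by simpa using h 0 le_rfl
  have := h ((u + 1) / a) (by positivity)
  rw [div_mul_cancel₀ _ ha.ne'] at this
  linarith

theorem exists_nonneg_multipliers {ι : Type*} [Fintype ι] {S : Set (ι → ℝ)} (hS : Convex ℝ S)
    (hne : S.Nonempty) (h : ∀ s ∈ S, ∃ i, s i ≤ 0) :
    ∃ l : ι → ℝ, 0 ≤ l ∧ l ≠ 0 ∧ ∀ s ∈ S, ∑ i, l i * s i ≤ 0 := by
  classical
  let P : Set (ι → ℝ) := Set.univ.pi fun _ => Set.Ioi 0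
  have hPS : Disjoint P S := Set.disjoint_left.2 fun s hsP hsS =>
    let ⟨i, hi⟩ := h s hsS
    hi.not_gt (hsP i trivial)
  obtain ⟨f, u, hfP, hfS⟩ := geometric_hahn_banach_open (convex_pi fun _ _ => convex_Ioi 0)
    (isOpen_set_pi Set.finite_univ fun _ _ => isOpen_Ioi) hS hPS
  have hclosure : closure P = Set.Ici 0 := by
    simp only [P, closure_pi_set, closure_Ioi, Set.pi_univ_Ici]
    rfl
  have hfu : ∀ x, 0 ≤ x → f x ≤ u := fun x hx =>
    closure_minimal (fun y hy => (hfP y hy).le) (isClosed_le f.continuous continuous_const)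
      (hclosure ▸ hx)
  have hu : 0 ≤ u := by simpa using hfu 0 le_rfl
  have hf_nonpos : ∀ x, 0 ≤ x → f x ≤ 0 := fun x hx =>
    nonpos_of_forall_mul_le fun t ht => by simpa using hfu (t • x) (smul_nonneg ht hx)
  have hf_sum : ∀ x, f x = ∑ i, f (Pi.single i 1) * x i := fun x => by
    conv_lhs => rw [pi_eq_sum_univ' x]
    simp [mul_comm]
  refine ⟨fun i => -f (Pi.single i 1), fun i => ?_, fun hzero => ?_, fun s hs => ?_⟩
  · exact neg_nonneg.2 (hf_nonpos _ (Pi.single_nonneg.2 zero_le_one))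
  · obtain ⟨s, hs⟩ := hne
    have hf : ∀ x, f x = 0 := fun x => by
      rw [hf_sum]
      exact Finset.sum_eq_zero fun i _ => by rw [neg_eq_zero.1 (congrFun hzero i), zero_mul]
    have h1 := hfP 1 fun _ _ => Set.mem_Ioi.2 one_pos
    have h2 := hfS s hs
    rw [hf] at h1 h2
    exact h1.not_ge h2
  · simpa [hf_sum s] using hu.trans (hfS s hs)

theorem eq_zero_of_sum_mul_nonpos {ι : Type*} [Fintype ι] {l g : ι → ℝ} (hl : 0 ≤ l)
    (hg : ∀ i, 0 < g i) (h : ∑ i, l i * g i ≤ 0) : l = 0 := by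
  have hterm : ∀ i ∈ Finset.univ, 0 ≤ l i * g i := fun i _ => mul_nonneg (hl i) (hg i).le
  have hzero := (Finset.sum_eq_zero_iff_of_nonneg hterm).1 (h.antisymm (Finset.sum_nonneg hterm))
  exact funext fun i => (mul_eq_zero.1 (hzero i (Finset.mem_univ i))).resolve_right (hg i).ne'

theorem exists_lagrange_multipliers {V ι : Type*} [AddCommMonoid V] [Module ℝ V] [Fintype ι]
    {S : Set V} {f : V → ℝ} {g : ι → V → ℝ} (hf : ConcaveOn ℝ S f)
    (hg : ∀ i, ConcaveOn ℝ S (g i)) (hfg : ∀ y ∈ S, (∀ i, 0 < g i y) → f y ≤ 0)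
    (hslater : ∃ y ∈ S, ∀ i, 0 < g i y) :
    ∃ l : ι → ℝ, 0 ≤ l ∧ ∀ y ∈ S, f y + ∑ i, l i * g i y ≤ 0 := by
  obtain ⟨y₀, hy₀S, hy₀⟩ := hslater
  let D : Set (Option ι → ℝ) := {s | ∃ y ∈ S, s none ≤ f y ∧ ∀ i, s (some i) ≤ g i y}
  have hD : Convex ℝ D := by
    rintro s ⟨y, hyS, hsf, hsg⟩ s' ⟨y', hyS', hsf', hsg'⟩ a b ha hb hab
    refine ⟨a • y + b • y', hf.1 hyS hyS' ha hb hab, ?_, fun i => ?_⟩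
    · exact (add_le_add (mul_le_mul_of_nonneg_left hsf ha)
        (mul_le_mul_of_nonneg_left hsf' hb)).trans (hf.2 hyS hyS' ha hb hab)
    · exact (add_le_add (mul_le_mul_of_nonneg_left (hsg i) ha)
        (mul_le_mul_of_nonneg_left (hsg' i) hb)).trans ((hg i).2 hyS hyS' ha hb hab)
  have hmem : ∀ y ∈ S, (fun o => o.elim (f y) fun i => g i y) ∈ D := fun y hy =>
    ⟨y, hy, le_rfl, fun _ => le_rfl⟩
  have hD_nonpos : ∀ s ∈ D, ∃ o, s o ≤ 0 := by
    rintro s ⟨y, hyS, hsf, hsg⟩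
    by_contra! hs
    exact (hsf.trans (hfg y hyS fun i => (hs _).trans_le (hsg i))).not_gt (hs none)
  obtain ⟨l, hl, hl_ne, hlD⟩ := exists_nonneg_multipliers hD ⟨_, hmem y₀ hy₀S⟩ hD_nonpos
  have hlag : ∀ y ∈ S, l none * f y + ∑ i, l (some i) * g i y ≤ 0 := fun y hy => by
    simpa [Fintype.sum_option] using hlD _ (hmem y hy)
  have hl_none : 0 < l none := by
    refine (hl none).lt_of_ne' fun h0 => hl_ne ?_
    have hl_some : (fun i => l (some i)) = 0 :=
      eq_zero_of_sum_mul_nonpos (fun i => hl _) hy₀ (by simpa [h0] using hlag y₀ hy₀S)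
    exact funext (Option.rec h0 (congrFun hl_some))
  refine ⟨fun i => l (some i) / l none, fun i => div_nonneg (hl _) (hl _), fun y hy => ?_⟩
  have := div_nonpos_of_nonpos_of_nonneg (hlag y hy) hl_none.le
  rwa [add_div, mul_div_cancel_left₀ _ hl_none.ne', Finset.sum_div,
    Finset.sum_congr rfl fun i _ => mul_div_right_comm _ _ _] at this

section Centrality

variable {k d : ℕ} {Z : Fin k → EuclideanSpace ℝ (Fin d)} {x : EuclideanSpace ℝ (Fin d)}
  {r p : ℝ} {Y : Matrix (BlockIdx k d) (BlockIdx k d) ℝ}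

/-- The slacks of the constraints `Tr U ≤ 1`, `B_ii ≤ 1` and `⟨Z_i - x, W_i⟩ ≥ r b_i` of the
centrality SDP, in this order. They are made linear in the block matrix by replacing the
constant `1` by the corner entry. -/
noncomputable def centralitySlack (Z : Fin k → EuclideanSpace ℝ (Fin d))
    (x : EuclideanSpace ℝ (Fin d)) (r : ℝ) :
    Unit ⊕ Fin k ⊕ Fin k → Matrix (BlockIdx k d) (BlockIdx k d) ℝ →ₗ[ℝ] ℝ
  | .inl _ => Matrix.entryLinearMap ℝ ℝ .one .one - ∑ j, Matrix.entryLinearMap ℝ ℝ (.u j) (.u j)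
  | .inr (.inl i) =>
    Matrix.entryLinearMap ℝ ℝ .one .one - Matrix.entryLinearMap ℝ ℝ (.b i) (.b i)
  | .inr (.inr i) =>
    ∑ j, (Z i j - x j) • Matrix.entryLinearMap ℝ ℝ (.b i) (.u j)
      - r • Matrix.entryLinearMap ℝ ℝ .one (.b i)

/-- The excess `∑ b_i - p k` of the objective of the centrality SDP over the level `p`, made
linear in the block matrix in the same way. -/
noncomputable def centralityExcess (k d : ℕ) (p : ℝ) :
    Matrix (BlockIdx k d) (BlockIdx k d) ℝ →ₗ[ℝ] ℝ :=
  ∑ i, Matrix.entryLinearMap ℝ ℝ .one (.b i) - (p * k) • Matrix.entryLinearMap ℝ ℝ .one .one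

theorem centralityFeasible_of_slack_nonneg (hY : Y.PosSemidef)
    (hone : Y BlockIdx.one BlockIdx.one = 1) (hslack : ∀ i, 0 ≤ centralitySlack Z x r i Y) :
    CentralityFeasible Z x r Y where
  posSemidef := hY
  corner := hone
  diag_le i := by simpa [centralitySlack, hone] using hslack (.inr (.inl i))
  trace_le := by simpa [centralitySlack, hone] using hslack (.inl ())
  shift i := by simpa [centralitySlack] using hslack (.inr (.inr i))

theorem CentralityFeasible.sum_le (hY : CentralityFeasible Z x r Y)
    (hx : CertifiablyCentral Z r p x) : ∑ i, Y BlockIdx.one (BlockIdx.b i) ≤ p * k := by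
  rcases k.eq_zero_or_pos with rfl | hk
  · simp
  · have hk' : (0 : ℝ) < k := Nat.cast_pos.2 hk
    have h : centralityObjective Y ≤ p :=
      (le_csSup (centralityValues_bddAbove Z x r) ⟨Y, hY, rfl⟩).trans hx
    rwa [centralityObjective, one_div_mul_eq_div, div_le_iff₀ hk'] at h

theorem CertifiablyCentral.excess_nonpos (hx : CertifiablyCentral Z r p x) (hY : Y.PosSemidef)
    (hslack : ∀ i, 0 < centralitySlack Z x r i Y) : centralityExcess k d p Y ≤ 0 := by
  set y := Y BlockIdx.one BlockIdx.one with hy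
  have hy_pos : 0 < y := by
    have htrace : 0 < y - ∑ j, Y (BlockIdx.u j) (BlockIdx.u j) := by
      simpa [centralitySlack] using hslack (.inl ())
    have hU : 0 ≤ ∑ j, Y (BlockIdx.u j) (BlockIdx.u j) :=
      Finset.sum_nonneg fun j _ => hY.diag_nonneg
    linarith
  have hfeas : CentralityFeasible Z x r (y⁻¹ • Y) :=
    centralityFeasible_of_slack_nonneg (hY.smul (inv_nonneg.2 hy_pos.le))
      (by simp [← hy, hy_pos.ne']) fun i => by
        rw [map_smul]
        exact smul_nonneg (inv_nonneg.2 hy_pos.le) (hslack i).le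
  have h := hfeas.sum_le hx
  simp only [Matrix.smul_apply, smul_eq_mul, ← Finset.mul_sum, inv_mul_le_iff₀ hy_pos] at h
  simpa [centralityExcess, ← hy, mul_comm] using h

variable (Z x) in
theorem exists_centralitySlack_pos (hr : 0 < r) :
    ∃ Y : Matrix (BlockIdx k d) (BlockIdx k d) ℝ,
      Y.PosSemidef ∧ ∀ i, 0 < centralitySlack Z x r i Y := by
  let w : BlockIdx k d → ℝ := Sum.elim (fun _ => 1) (Sum.elim (fun _ => -1 / 2) fun _ => 0)
  refine ⟨_, Matrix.posSemidef_vecMulVec_self_star w, ?_⟩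
  rintro (_ | i | i)
  · simp [centralitySlack, Matrix.vecMulVec, w]
  · norm_num [centralitySlack, Matrix.vecMulVec, w]
  · have : r * (-1 / 2) < 0 := by linarith
    simpa [centralitySlack, Matrix.vecMulVec, w] using this

/-- Lagrange multipliers `α`, `β`, `γ` of the constraints `⟨Z_i - x, W_i⟩ ≥ r b_i`, `B_ii ≤ 1`
and `Tr U ≤ 1` that certify the bound `p` on the value of the centrality SDP. The Lagrangian
inequality is homogenized by the corner entry of the block matrix. -/
structure CentralityDual (Z : Fin k → EuclideanSpace ℝ (Fin d))
    (x : EuclideanSpace ℝ (Fin d)) (r p : ℝ) (α β : Fin k → ℝ) (γ : ℝ) : Prop where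
  alpha_nonneg : ∀ i, 0 ≤ α i
  beta_nonneg : ∀ i, 0 ≤ β i
  gamma_nonneg : 0 ≤ γ
  lagrangian_le : ∀ Y : Matrix (BlockIdx k d) (BlockIdx k d) ℝ, Y.PosSemidef →
    ∑ i, α i * (∑ j, (Z i j - x j) * Y (.b i) (.u j) - r * Y .one (.b i))
      + ∑ i, β i * (Y .one .one - Y (.b i) (.b i)) + γ * (Y .one .one - ∑ j, Y (.u j) (.u j))
    ≤ p * k * Y .one .one - ∑ i, Y .one (.b i)

theorem CertifiablyCentral.exists_dual (hr : 0 < r) (hx : CertifiablyCentral Z r p x) :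
    ∃ (α β : Fin k → ℝ) (γ : ℝ), CentralityDual Z x r p α β γ := by
  have hconv : Convex ℝ {Y : Matrix (BlockIdx k d) (BlockIdx k d) ℝ | Y.PosSemidef} :=
    fun _ hY _ hY' _ _ ha hb _ =>
      (Matrix.PosSemidef.smul hY ha).add (Matrix.PosSemidef.smul hY' hb)
  obtain ⟨l, hl, hlag⟩ := exists_lagrange_multipliers
    ((centralityExcess k d p).concaveOn hconv) (fun i => (centralitySlack Z x r i).concaveOn hconv)
    (fun Y hY hslack => hx.excess_nonpos hY hslack) (exists_centralitySlack_pos Z x hr)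
  refine ⟨fun i => l (.inr (.inr i)), fun i => l (.inr (.inl i)), l (.inl ()),
    fun i => hl _, fun i => hl _, hl _, fun Y hY => ?_⟩
  have h := hlag Y hY
  simp only [centralityExcess, centralitySlack, Fintype.sum_sum_type, Finset.univ_unique,
    PUnit.default_eq_unit, Finset.sum_singleton, LinearMap.sub_apply, LinearMap.smul_apply,
    LinearMap.coe_sum, Finset.sum_apply, Matrix.entryLinearMap_apply, smul_eq_mul] at h
  linarith

theorem CentralityDual.gamma_le {α β : Fin k → ℝ} {γ : ℝ} (h : CentralityDual Z x r p α β γ) :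
    γ ≤ p * k := by
  let w : BlockIdx k d → ℝ := Sum.elim (fun _ => 1) fun _ => 0
  have hw : ∑ i, β i + γ ≤ p * k := by
    simpa [Matrix.vecMulVec, w] using
      h.lagrangian_le _ (Matrix.posSemidef_vecMulVec_self_star w)
  have := Finset.sum_nonneg fun i (_ : i ∈ Finset.univ) => h.beta_nonneg i
  linarith

end Centrality

open MvPolynomial

section Degree

variable {σ τ R : Type*} [CommRing R] {m n m' n' : ℕ}

theorem totalDegree_mul_le_of_le {p q : MvPolynomial σ R} (hp : p.totalDegree ≤ m)
    (hq : q.totalDegree ≤ n) : (p * q).totalDegree ≤ m + n :=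
  (totalDegree_mul p q).trans (add_le_add hp hq)

theorem totalDegree_pow_le_of_le {p : MvPolynomial σ R} (hp : p.totalDegree ≤ m) (n : ℕ) :
    (p ^ n).totalDegree ≤ n * m :=
  (totalDegree_pow p n).trans (Nat.mul_le_mul_left n hp)

theorem totalDegree_add_le_of_le {p q : MvPolynomial σ R} (hp : p.totalDegree ≤ n)
    (hq : q.totalDegree ≤ n) : (p + q).totalDegree ≤ n :=
  (totalDegree_add p q).trans (max_le hp hq)

theorem totalDegree_sub_le_of_le {p q : MvPolynomial σ R} (hp : p.totalDegree ≤ n)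
    (hq : q.totalDegree ≤ n) : (p - q).totalDegree ≤ n :=
  (totalDegree_sub p q).trans (max_le hp hq)

/-- The polynomial `P`, whose coefficients are themselves polynomials, has total degree at most
`m`, and its coefficients have total degree at most `n`. -/
structure BidegreeLE (m n : ℕ) (P : MvPolynomial τ (MvPolynomial σ R)) : Prop where
  totalDegree_le : P.totalDegree ≤ m
  totalDegree_coeff_le : ∀ e, (P.coeff e).totalDegree ≤ n

namespace BidegreeLE

variable {P Q : MvPolynomial τ (MvPolynomial σ R)}

theorem mono (hP : BidegreeLE m n P) (hm : m ≤ m') (hn : n ≤ n') : BidegreeLE m' n' P :=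
  ⟨hP.1.trans hm, fun e => (hP.2 e).trans hn⟩

theorem add (hP : BidegreeLE m n P) (hQ : BidegreeLE m n Q) : BidegreeLE m n (P + Q) :=
  ⟨totalDegree_add_le_of_le hP.1 hQ.1, fun e => by
    rw [coeff_add]
    exact totalDegree_add_le_of_le (hP.2 e) (hQ.2 e)⟩

theorem sub (hP : BidegreeLE m n P) (hQ : BidegreeLE m n Q) : BidegreeLE m n (P - Q) :=
  ⟨totalDegree_sub_le_of_le hP.1 hQ.1, fun e => by
    rw [coeff_sub]
    exact totalDegree_sub_le_of_le (hP.2 e) (hQ.2 e)⟩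

theorem sum {ι : Type*} {s : Finset ι} {f : ι → MvPolynomial τ (MvPolynomial σ R)}
    (h : ∀ i ∈ s, BidegreeLE m n (f i)) : BidegreeLE m n (∑ i ∈ s, f i) :=
  ⟨totalDegree_finsetSum_le fun i hi => (h i hi).1, fun e => by
    rw [coeff_sum]
    exact totalDegree_finsetSum_le fun i hi => (h i hi).2 e⟩

theorem mul (hP : BidegreeLE m n P) (hQ : BidegreeLE m' n' Q) :
    BidegreeLE (m + m') (n + n') (P * Q) :=
  ⟨totalDegree_mul_le_of_le hP.1 hQ.1, fun e => by
    classical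
    rw [coeff_mul]
    exact totalDegree_finsetSum_le fun ij _ => totalDegree_mul_le_of_le (hP.2 _) (hQ.2 _)⟩

theorem one : BidegreeLE 0 0 (1 : MvPolynomial τ (MvPolynomial σ R)) :=
  ⟨totalDegree_one.le, fun e => by
    classical
    rw [coeff_one]
    split_ifs <;> simp⟩

theorem pow (hP : BidegreeLE m n P) (l : ℕ) : BidegreeLE (l * m) (l * n) (P ^ l) := by
  induction l with
  | zero => simpa using one
  | succ l ih => simpa only [pow_succ, Nat.succ_mul] using ih.mul hP

theorem C {p : MvPolynomial σ R} (hp : p.totalDegree ≤ n) :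
    BidegreeLE 0 n (C p : MvPolynomial τ (MvPolynomial σ R)) :=
  ⟨(totalDegree_C p).le, fun e => by
    classical
    rw [coeff_C]
    split_ifs
    exacts [hp, totalDegree_zero.le.trans n.zero_le]⟩

theorem X [Nontrivial R] (i : τ) : BidegreeLE 1 0 (X i : MvPolynomial τ (MvPolynomial σ R)) :=
  ⟨(totalDegree_X i).le, fun e => by
    classical
    rw [coeff_X]
    split_ifs <;> simp⟩

theorem totalDegree_coeff_mul_prod_le (hP : BidegreeLE m n P) {w : τ → MvPolynomial σ R} {l : ℕ}
    (hw : ∀ i, (w i).totalDegree ≤ l) {e : τ →₀ ℕ} (he : e ∈ P.support) :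
    (P.coeff e * ∏ i ∈ e.support, w i ^ e i).totalDegree ≤ n + m * l := by
  refine totalDegree_mul_le_of_le (hP.2 e) ((totalDegree_finsetProd _ _).trans ?_)
  calc ∑ i ∈ e.support, (w i ^ e i).totalDegree
      ≤ ∑ i ∈ e.support, e i * l :=
        Finset.sum_le_sum fun i _ => totalDegree_pow_le_of_le (hw i) (e i)
    _ = (e.sum fun _ j => j) * l := (Finset.sum_mul _ _ _).symm
    _ ≤ m * l := Nat.mul_le_mul_right l ((le_totalDegree he).trans hP.1)

end BidegreeLE

end Degree

namespace PseudoExpectation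

variable {V : Type} {n : ℕ} (E : PseudoExpectation V n) {p q : MvPolynomial V ℝ}

/-- A linear extension of a pseudoexpectation to all polynomials, which saves carrying
membership proofs. It is arbitrary above degree `n`. -/
noncomputable def extend : MvPolynomial V ℝ →ₗ[ℝ] ℝ :=
  (LinearMap.exists_extend E.toLinearMap).choose

theorem extend_eq (hp : p ∈ restrictTotalDegree V ℝ n) : E.extend p = E.toLinearMap ⟨p, hp⟩ :=
  LinearMap.congr_fun (LinearMap.exists_extend E.toLinearMap).choose_spec ⟨p, hp⟩

theorem extend_one : E.extend 1 = 1 := by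
  rw [E.extend_eq (by simp [mem_restrictTotalDegree]), E.map_one _ rfl]

theorem extend_C_mul (c : ℝ) (p : MvPolynomial V ℝ) : E.extend (C c * p) = c * E.extend p := by
  rw [← smul_eq_C_mul, map_smul, smul_eq_mul]

theorem extend_sq_nonneg (hq : 2 * q.totalDegree ≤ n) : 0 ≤ E.extend (q ^ 2) := by
  rw [E.extend_eq ((mem_restrictTotalDegree V n _).2 ((totalDegree_pow q 2).trans hq))]
  exact E.map_sq_nonneg q _ hq rfl

theorem posSemidef_moments {ι : Type*} {w : ι → MvPolynomial V ℝ}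
    (hw : ∀ i, 2 * (q * w i).totalDegree ≤ n) :
    (Matrix.of fun i j => E.extend (q ^ 2 * (w i * w j))).PosSemidef := by
  refine ⟨by ext i j; simp [mul_comm], fun z => ?_⟩
  have hdeg : 2 * (z.sum fun i zi => C zi * (q * w i)).totalDegree ≤ n := by
    suffices (z.sum fun i zi => C zi * (q * w i)).totalDegree ≤ n / 2 by omega
    refine totalDegree_finsetSum_le fun i _ => ?_
    change (C (z i) * (q * w i)).totalDegree ≤ n / 2
    rw [C_mul']
    exact (totalDegree_smul_le _ _).trans (by have := hw i; omega)
  have hsq := E.extend_sq_nonneg hdeg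
  rw [Finsupp.sum, pow_two, Finset.sum_mul_sum, map_sum] at hsq
  refine hsq.trans_eq (Finset.sum_congr rfl fun i _ => ?_)
  rw [map_sum]
  refine Finset.sum_congr rfl fun j _ => ?_
  change _ = z i * E.extend (q ^ 2 * (w i * w j)) * z j
  rw [mul_mul_mul_comm, ← C_mul, E.extend_C_mul, mul_mul_mul_comm q, ← pow_two, mul_right_comm]

variable {E}

theorem SatisfiesEq.extend_mul_eq_zero (h : E.SatisfiesEq p) (hpq : (p * q).totalDegree ≤ n) :
    E.extend (p * q) = 0 := by
  have hmem := (mem_restrictTotalDegree V n (p * q)).2 hpq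
  rw [E.extend_eq hmem]
  exact h q hmem

theorem SatisfiesIneq.extend_mul_sq_nonneg (h : E.SatisfiesIneq p)
    (hpq : (p * q ^ 2).totalDegree ≤ n) : 0 ≤ E.extend (p * q ^ 2) := by
  have hmem := (mem_restrictTotalDegree V n (p * q ^ 2)).2 hpq
  rw [E.extend_eq hmem]
  exact h q hmem

theorem SatisfiesEq.satisfiesIneq (h : E.SatisfiesEq p) : E.SatisfiesIneq p :=
  fun q hq => (h (q ^ 2) hq).ge

theorem SatisfiesEq.neg (h : E.SatisfiesEq p) : E.SatisfiesEq (-p) := fun q hq => by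
  have hmem : p * -q ∈ restrictTotalDegree V ℝ n := by rwa [mul_neg, ← neg_mul]
  simpa only [mul_neg, neg_mul] using h (-q) hmem

theorem extend_mul_eval_eq_zero {τ : Type*} {P : MvPolynomial τ (MvPolynomial V ℝ)} {m₁ m₂ l : ℕ}
    (hP : BidegreeLE m₁ m₂ P) (hE : ∀ e, E.SatisfiesEq (P.coeff e))
    {w : τ → MvPolynomial V ℝ} (hw : ∀ i, (w i).totalDegree ≤ l)
    (hp : p.totalDegree + (m₂ + m₁ * l) ≤ n) : E.extend (p * eval w P) = 0 := by
  rw [eval_eq, Finset.mul_sum, map_sum]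
  refine Finset.sum_eq_zero fun e he => ?_
  have hdeg := totalDegree_mul_le_of_le le_rfl (hP.totalDegree_coeff_mul_prod_le hw he) (p := p)
  rw [mul_left_comm] at hdeg ⊢
  exact (hE e).extend_mul_eq_zero (hdeg.trans hp)

end PseudoExpectation

namespace PseudoExpectation

variable {V : Type} {n : ℕ} {τ : Type*} [Fintype τ] {E : PseudoExpectation V n}
  {a : τ → MvPolynomial V ℝ} {u : τ → ℝ} {α p q : MvPolynomial V ℝ} {s : ℝ}

/-- The linear polynomials `a t` are pseudo-indicators of a partition: `E` satisfies that they are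
idempotent, pairwise orthogonal and sum to one. -/
structure IsPartition (E : PseudoExpectation V n) (a : τ → MvPolynomial V ℝ) : Prop where
  totalDegree_le : ∀ t, (a t).totalDegree ≤ 1
  sq_sub_self : ∀ t, E.SatisfiesEq (a t ^ 2 - a t)
  mul_of_ne : ∀ t t', t ≠ t' → E.SatisfiesEq (a t * a t')
  sum_sub_one : E.SatisfiesEq (∑ t, a t - 1)

/-- The polynomial counterpart of the step function with value `m t` on the part `t` of a
partition with indicators `a`. -/
noncomputable def stepPoly (a : τ → MvPolynomial V ℝ) (m : τ → ℝ) : MvPolynomial V ℝ :=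
  ∑ t, C (m t) * a t

theorem extend_mul_stepPoly (E : PseudoExpectation V n) (a : τ → MvPolynomial V ℝ) (m : τ → ℝ)
    (p : MvPolynomial V ℝ) : E.extend (p * stepPoly a m) = ∑ t, m t * E.extend (p * a t) := by
  rw [stepPoly, Finset.mul_sum, map_sum]
  exact Finset.sum_congr rfl fun t _ => by rw [mul_left_comm, E.extend_C_mul]

namespace IsPartition

theorem totalDegree_stepPoly_le (ha : E.IsPartition a) (m : τ → ℝ) :
    (stepPoly a m).totalDegree ≤ 1 :=
  totalDegree_finsetSum_le fun t _ => by
    rw [C_mul']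
    exact (totalDegree_smul_le _ _).trans (ha.totalDegree_le t)

theorem sum_extend_mul (ha : E.IsPartition a) (hp : p.totalDegree + 1 ≤ n) :
    ∑ t, E.extend (p * a t) = E.extend p := by
  have hsum : (∑ t, a t - 1).totalDegree ≤ 1 := totalDegree_sub_le_of_le
    (totalDegree_finsetSum_le fun t _ => ha.totalDegree_le t) (by simp)
  have h := ha.sum_sub_one.extend_mul_eq_zero (q := p)
    ((totalDegree_mul_le_of_le hsum le_rfl).trans (by omega))
  rwa [mul_comm, mul_sub, mul_one, Finset.mul_sum, map_sub, map_sum, sub_eq_zero] at h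

theorem extend_mul_sq (ha : E.IsPartition a) (t : τ) (hp : p.totalDegree + 2 ≤ n) :
    E.extend (p * a t ^ 2) = E.extend (p * a t) := by
  have hidem : (a t ^ 2 - a t).totalDegree ≤ 2 := totalDegree_sub_le_of_le
    (totalDegree_pow_le_of_le (ha.totalDegree_le t) 2) ((ha.totalDegree_le t).trans one_le_two)
  have h := (ha.sq_sub_self t).extend_mul_eq_zero (q := p)
    ((totalDegree_mul_le_of_le hidem le_rfl).trans (by omega))
  rwa [mul_comm, mul_sub, map_sub, sub_eq_zero] at h

theorem extend_mul_mul_of_ne (ha : E.IsPartition a) {t t' : τ} (htt : t ≠ t')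
    (hp : p.totalDegree + 2 ≤ n) : E.extend (p * (a t * a t')) = 0 := by
  rw [mul_comm]
  exact (ha.mul_of_ne t t' htt).extend_mul_eq_zero ((totalDegree_mul_le_of_le
    (totalDegree_mul_le_of_le (ha.totalDegree_le t) (ha.totalDegree_le t')) le_rfl).trans
      (by omega))

theorem extend_mul_stepPoly_sq (ha : E.IsPartition a) (m : τ → ℝ) (hp : p.totalDegree + 2 ≤ n) :
    E.extend (p * stepPoly a m ^ 2) = ∑ t, m t ^ 2 * E.extend (p * a t) := by
  rw [stepPoly, pow_two, Finset.sum_mul_sum, Finset.mul_sum, map_sum]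
  refine Finset.sum_congr rfl fun t _ => ?_
  have hterm : ∀ t', E.extend (p * (C (m t) * a t * (C (m t') * a t'))) =
      m t * m t' * E.extend (p * (a t * a t')) := fun t' => by
    rw [mul_mul_mul_comm, ← C_mul, mul_left_comm, E.extend_C_mul]
  rw [Finset.mul_sum, map_sum, Finset.sum_eq_single t, hterm, ← pow_two, ← pow_two,
    ha.extend_mul_sq t hp]
  · intro t' _ ht'
    rw [hterm, ha.extend_mul_mul_of_ne ht'.symm hp, mul_zero]
  · exact fun ht => (ht (Finset.mem_univ t)).elim

theorem extend_sq_mul_nonneg (ha : E.IsPartition a) (t : τ) (hq : 2 * q.totalDegree + 2 ≤ n) :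
    0 ≤ E.extend (q ^ 2 * a t) := by
  have hdeg := totalDegree_mul_le_of_le (le_refl q.totalDegree) (ha.totalDegree_le t)
  rw [← ha.extend_mul_sq t ((Nat.add_le_add_right (totalDegree_pow q 2) 2).trans hq), ← mul_pow]
  exact E.extend_sq_nonneg (by omega)

theorem extend_sq_mul_mul_nonneg (ha : E.IsPartition a) (t : τ) (hp : E.SatisfiesIneq p)
    (hpq : 2 * q.totalDegree + p.totalDegree + 2 ≤ n) : 0 ≤ E.extend (q ^ 2 * p * a t) := by
  have hqp : (q ^ 2 * p).totalDegree ≤ 2 * q.totalDegree + p.totalDegree :=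
    totalDegree_mul_le_of_le (totalDegree_pow q 2) le_rfl
  have hqa : (q * a t).totalDegree ≤ q.totalDegree + 1 :=
    totalDegree_mul_le_of_le le_rfl (ha.totalDegree_le t)
  rw [← ha.extend_mul_sq t (by omega),
    show q ^ 2 * p * a t ^ 2 = p * (q * a t) ^ 2 by ring]
  exact hp.extend_mul_sq_nonneg ((totalDegree_mul_le_of_le le_rfl
    (totalDegree_pow_le_of_le hqa 2)).trans (by omega))

theorem extend_sq_mul_mul_stepPoly_le (ha : E.IsPartition a) {m : τ → ℝ} (hm : ∀ t, m t ≤ 1)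
    (hp : E.SatisfiesIneq p) (hpq : 2 * q.totalDegree + p.totalDegree + 2 ≤ n) :
    E.extend (q ^ 2 * p * stepPoly a m) ≤ E.extend (q ^ 2 * p) := by
  have hqp : (q ^ 2 * p).totalDegree ≤ 2 * q.totalDegree + p.totalDegree :=
    totalDegree_mul_le_of_le (totalDegree_pow q 2) le_rfl
  rw [extend_mul_stepPoly, ← ha.sum_extend_mul (by omega)]
  exact Finset.sum_le_sum fun t _ =>
    mul_le_of_le_one_left (ha.extend_sq_mul_mul_nonneg t hp hpq) (hm t)

theorem extend_sq_mul_mul_stepPoly_sq_le (ha : E.IsPartition a) {m : τ → ℝ}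
    (hm : ∀ t, |m t| ≤ 1) (hp : E.SatisfiesIneq p)
    (hpq : 2 * q.totalDegree + p.totalDegree + 2 ≤ n) :
    E.extend (q ^ 2 * p * stepPoly a m ^ 2) ≤ E.extend (q ^ 2 * p) := by
  have hqp : (q ^ 2 * p).totalDegree ≤ 2 * q.totalDegree + p.totalDegree :=
    totalDegree_mul_le_of_le (totalDegree_pow q 2) le_rfl
  rw [ha.extend_mul_stepPoly_sq m (by omega), ← ha.sum_extend_mul (by omega)]
  exact Finset.sum_le_sum fun t _ => mul_le_of_le_one_left
    (ha.extend_sq_mul_mul_nonneg t hp hpq) ((sq_le_one_iff_abs_le_one _).2 (hm t))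

end IsPartition

/-- The nonnegative linear polynomial `α` is bracketed along the partition with indicators `a`:
it lies between `u t / 2` and `u t` on the part `t`. The part where `u t = 0` is required to
satisfy `a t * α = 0` as an equation, which is stronger than the two inequalities. -/
structure IsBracketing (E : PseudoExpectation V n) (α : MvPolynomial V ℝ)
    (a : τ → MvPolynomial V ℝ) (u : τ → ℝ) : Prop extends IsPartition E a where
  totalDegree_alpha_le : α.totalDegree ≤ 1
  alpha_nonneg : E.SatisfiesIneq α
  bound_nonneg : ∀ t, 0 ≤ u t
  mul_of_bound_eq_zero : ∀ t, u t = 0 → E.SatisfiesEq (a t * α)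
  lower_bound : ∀ t, E.SatisfiesIneq (a t * α - a t * C (u t / 2))
  upper_bound : ∀ t, E.SatisfiesIneq (a t * C (u t) - a t * α)

/-- The number `min 1 (s / u)`, equal to `1` at `u = 0`. -/
noncomputable def capWeight (s u : ℝ) : ℝ := if u ≤ s then 1 else s / u

theorem capWeight_le_one {u : ℝ} (hu : 0 ≤ u) : capWeight s u ≤ 1 := by
  unfold capWeight
  split_ifs with h
  exacts [le_rfl, div_le_one_of_le₀ (not_le.1 h).le hu]

theorem capWeight_nonneg {u : ℝ} (hs : 0 ≤ s) (hu : 0 ≤ u) : 0 ≤ capWeight s u := by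
  unfold capWeight
  split_ifs
  exacts [zero_le_one, div_nonneg hs hu]

theorem capWeight_eq_mul_inv_max {u : ℝ} (hu : 0 < u) : capWeight s u = s * (max u s)⁻¹ := by
  unfold capWeight
  split_ifs with h
  · rw [max_eq_right h, mul_inv_cancel₀ (hu.trans_le h).ne']
  · rw [max_eq_left (not_le.1 h).le, div_eq_mul_inv]

theorem half_le_capWeight_add {u : ℝ} (hs : 0 ≤ s) (hu : 0 ≤ u) :
    1 / 2 ≤ capWeight s u + u / 2 * (max u s)⁻¹ := by
  unfold capWeight
  split_ifs with h
  · have : 0 ≤ u / 2 * (max u s)⁻¹ := by positivity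
    linarith
  · have hu' : 0 < u := hs.trans_lt (not_le.1 h)
    rw [max_eq_left (not_le.1 h).le, div_mul_eq_mul_div, mul_inv_cancel₀ hu'.ne']
    exact le_add_of_nonneg_left (div_nonneg hs hu)

/-- The polynomial counterpart of `min 1 (s / α)` for a polynomial `α` bracketed by the values `u`
along the partition with indicators `a`. -/
noncomputable def capPoly (a : τ → MvPolynomial V ℝ) (u : τ → ℝ) (s : ℝ) : MvPolynomial V ℝ :=
  stepPoly a fun t => capWeight s (u t)

/-- The polynomial counterpart of `min 1 (α / s)` for a polynomial `α` bracketed by the values `u`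
along the partition with indicators `a`. -/
noncomputable def ratioPoly (α : MvPolynomial V ℝ) (a : τ → MvPolynomial V ℝ) (u : τ → ℝ) (s : ℝ) :
    MvPolynomial V ℝ :=
  α * stepPoly a fun t => (max (u t) s)⁻¹

namespace IsBracketing

theorem totalDegree_capPoly_le (h : E.IsBracketing α a u) (s : ℝ) :
    (capPoly a u s).totalDegree ≤ 1 :=
  h.totalDegree_stepPoly_le _

theorem totalDegree_ratioPoly_le (h : E.IsBracketing α a u) (s : ℝ) :
    (ratioPoly α a u s).totalDegree ≤ 2 :=
  totalDegree_mul_le_of_le h.totalDegree_alpha_le (h.totalDegree_stepPoly_le _)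

theorem half_bound_mul_extend_le (h : E.IsBracketing α a u) (t : τ)
    (hq : 2 * q.totalDegree + 2 ≤ n) :
    u t / 2 * E.extend (q ^ 2 * a t) ≤ E.extend (q ^ 2 * α * a t) := by
  have hdeg : (a t * α - a t * C (u t / 2)).totalDegree ≤ 2 := totalDegree_sub_le_of_le
    (totalDegree_mul_le_of_le (h.totalDegree_le t) h.totalDegree_alpha_le)
    (totalDegree_mul_le_of_le (n := 1) (h.totalDegree_le t) (by simp))
  have hE := (h.lower_bound t).extend_mul_sq_nonneg (q := q)
    ((totalDegree_mul_le_of_le hdeg (totalDegree_pow q 2)).trans (by omega))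
  rwa [show (a t * α - a t * C (u t / 2)) * q ^ 2
    = q ^ 2 * α * a t - C (u t / 2) * (q ^ 2 * a t) by ring, map_sub, E.extend_C_mul,
    sub_nonneg] at hE

theorem extend_mul_le (h : E.IsBracketing α a u) (t : τ) (hq : 2 * q.totalDegree + 2 ≤ n) :
    E.extend (q ^ 2 * α * a t) ≤ u t * E.extend (q ^ 2 * a t) := by
  have hdeg : (a t * C (u t) - a t * α).totalDegree ≤ 2 := totalDegree_sub_le_of_le
    (totalDegree_mul_le_of_le (n := 1) (h.totalDegree_le t) (by simp))
    (totalDegree_mul_le_of_le (h.totalDegree_le t) h.totalDegree_alpha_le)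
  have hE := (h.upper_bound t).extend_mul_sq_nonneg (q := q)
    ((totalDegree_mul_le_of_le hdeg (totalDegree_pow q 2)).trans (by omega))
  rwa [show (a t * C (u t) - a t * α) * q ^ 2
    = C (u t) * (q ^ 2 * a t) - q ^ 2 * α * a t by ring, map_sub, E.extend_C_mul,
    sub_nonneg] at hE

theorem extend_mul_eq_zero (h : E.IsBracketing α a u) {t : τ} (ht : u t = 0)
    (hp : p.totalDegree + 2 ≤ n) : E.extend (p * α * a t) = 0 := by
  rw [show p * α * a t = a t * α * p by ring]
  exact (h.mul_of_bound_eq_zero t ht).extend_mul_eq_zero ((totalDegree_mul_le_of_le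
    (totalDegree_mul_le_of_le (h.totalDegree_le t) h.totalDegree_alpha_le) le_rfl).trans
      (by omega))

theorem extend_sq_mul_sq_mul_le (h : E.IsBracketing α a u) (t : τ)
    (hq : 2 * q.totalDegree + 5 ≤ n) :
    E.extend (q ^ 2 * α ^ 2 * a t) ≤ u t ^ 2 * E.extend (q ^ 2 * a t) := by
  have hα := h.totalDegree_alpha_le
  rcases (h.bound_nonneg t).eq_or_lt' with ht | ht
  · have hdeg : (q ^ 2 * α).totalDegree ≤ 2 * q.totalDegree + 1 :=
      totalDegree_mul_le_of_le (totalDegree_pow q 2) hα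
    rw [pow_two α, ← mul_assoc, h.extend_mul_eq_zero ht (by omega), ht]
    simp
  have hqα : (q * α).totalDegree ≤ q.totalDegree + 1 := totalDegree_mul_le_of_le le_rfl hα
  have hqu : (q * (C (u t) - α)).totalDegree ≤ q.totalDegree + 1 :=
    totalDegree_mul_le_of_le le_rfl (totalDegree_sub_le_of_le (by simp) hα)
  have hcube : E.extend (q ^ 2 * α ^ 3 * a t) ≤ u t * E.extend (q ^ 2 * α ^ 2 * a t) := by
    have hle := h.extend_mul_le t (q := q * α) (by omega)
    rwa [show (q * α) ^ 2 * α * a t = q ^ 2 * α ^ 3 * a t by ring, mul_pow] at hle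
  have hnonneg : 0 ≤ E.extend ((q * (C (u t) - α)) ^ 2 * α * a t) :=
    h.extend_sq_mul_mul_nonneg t h.alpha_nonneg (by omega)
  have hexpand : (q * (C (u t) - α)) ^ 2 * α * a t = C (u t ^ 2) * (q ^ 2 * α * a t)
      - C (2 * u t) * (q ^ 2 * α ^ 2 * a t) + q ^ 2 * α ^ 3 * a t := by
    simp only [C_mul, C_pow, map_ofNat]
    ring
  rw [hexpand, map_add, map_sub, E.extend_C_mul, E.extend_C_mul] at hnonneg
  have hsq : u t * E.extend (q ^ 2 * α ^ 2 * a t) ≤ u t * (u t * E.extend (q ^ 2 * α * a t)) := by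
    linarith
  calc E.extend (q ^ 2 * α ^ 2 * a t)
      ≤ u t * E.extend (q ^ 2 * α * a t) := le_of_mul_le_mul_left hsq ht
    _ ≤ u t * (u t * E.extend (q ^ 2 * a t)) :=
        mul_le_mul_of_nonneg_left (h.extend_mul_le t (by omega)) ht.le
    _ = u t ^ 2 * E.extend (q ^ 2 * a t) := by ring

theorem extend_sq_mul_mul_capPoly_le (h : E.IsBracketing α a u) (hp : E.SatisfiesIneq p)
    (hpq : 2 * q.totalDegree + p.totalDegree + 2 ≤ n) :
    E.extend (q ^ 2 * p * capPoly a u s) ≤ E.extend (q ^ 2 * p) :=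
  h.extend_sq_mul_mul_stepPoly_le (fun t => capWeight_le_one (h.bound_nonneg t)) hp hpq

theorem extend_sq_mul_mul_capPoly_sq_le (h : E.IsBracketing α a u) (hs : 0 ≤ s)
    (hp : E.SatisfiesIneq p) (hpq : 2 * q.totalDegree + p.totalDegree + 2 ≤ n) :
    E.extend (q ^ 2 * p * capPoly a u s ^ 2) ≤ E.extend (q ^ 2 * p) :=
  h.extend_sq_mul_mul_stepPoly_sq_le (fun t => by
    rw [abs_of_nonneg (capWeight_nonneg hs (h.bound_nonneg t))]
    exact capWeight_le_one (h.bound_nonneg t)) hp hpq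

theorem extend_sq_mul_ratioPoly_sq_le (h : E.IsBracketing α a u) (s : ℝ)
    (hq : 2 * q.totalDegree + 5 ≤ n) :
    E.extend (q ^ 2 * ratioPoly α a u s ^ 2) ≤ E.extend (q ^ 2) := by
  have hq2 := totalDegree_pow q 2
  have hqα : (q ^ 2 * α ^ 2).totalDegree ≤ 2 * q.totalDegree + 2 :=
    totalDegree_mul_le_of_le hq2 (totalDegree_pow_le_of_le h.totalDegree_alpha_le 2)
  rw [ratioPoly, mul_pow, ← mul_assoc, h.extend_mul_stepPoly_sq _ (by omega),
    ← h.sum_extend_mul (by omega)]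
  refine Finset.sum_le_sum fun t _ => ?_
  have hu := h.bound_nonneg t
  have hw : (max (u t) s)⁻¹ * u t ≤ 1 := inv_mul_le_one_of_le₀ (le_max_left _ _)
    (hu.trans (le_max_left _ _))
  calc (max (u t) s)⁻¹ ^ 2 * E.extend (q ^ 2 * α ^ 2 * a t)
      ≤ (max (u t) s)⁻¹ ^ 2 * (u t ^ 2 * E.extend (q ^ 2 * a t)) :=
        mul_le_mul_of_nonneg_left (h.extend_sq_mul_sq_mul_le t hq) (sq_nonneg _)
    _ = ((max (u t) s)⁻¹ * u t) ^ 2 * E.extend (q ^ 2 * a t) := by ring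
    _ ≤ E.extend (q ^ 2 * a t) := mul_le_of_le_one_left (h.extend_sq_mul_nonneg t (by omega))
        (pow_le_one₀ (mul_nonneg (inv_nonneg.2 (hu.trans (le_max_left _ _))) hu) hw)

theorem half_le_extend_capPoly_add_ratioPoly (h : E.IsBracketing α a u) (hs : 0 ≤ s)
    (hq : 2 * q.totalDegree + 2 ≤ n) :
    1 / 2 * E.extend (q ^ 2)
      ≤ E.extend (q ^ 2 * capPoly a u s) + E.extend (q ^ 2 * ratioPoly α a u s) := by
  have hq2 := totalDegree_pow q 2
  rw [capPoly, ratioPoly, ← mul_assoc, extend_mul_stepPoly, extend_mul_stepPoly,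
    ← h.sum_extend_mul (by omega), Finset.mul_sum, ← Finset.sum_add_distrib]
  refine Finset.sum_le_sum fun t _ => ?_
  calc 1 / 2 * E.extend (q ^ 2 * a t)
      ≤ (capWeight s (u t) + u t / 2 * (max (u t) s)⁻¹) * E.extend (q ^ 2 * a t) :=
        mul_le_mul_of_nonneg_right (half_le_capWeight_add hs (h.bound_nonneg t))
          (h.extend_sq_mul_nonneg t hq)
    _ = capWeight s (u t) * E.extend (q ^ 2 * a t)
          + (max (u t) s)⁻¹ * (u t / 2 * E.extend (q ^ 2 * a t)) := by ring
    _ ≤ _ := add_le_add_right (mul_le_mul_of_nonneg_left (h.half_bound_mul_extend_le t hq)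
        (inv_nonneg.2 ((h.bound_nonneg t).trans (le_max_left _ _)))) _

theorem extend_mul_capPoly_eq (h : E.IsBracketing α a u) (s : ℝ) (hp : p.totalDegree + 2 ≤ n) :
    E.extend (p * (α * capPoly a u s)) = s * E.extend (p * ratioPoly α a u s) := by
  rw [capPoly, ratioPoly, ← mul_assoc, ← mul_assoc, extend_mul_stepPoly, extend_mul_stepPoly,
    Finset.mul_sum]
  refine Finset.sum_congr rfl fun t _ => ?_
  rcases (h.bound_nonneg t).eq_or_lt' with ht | ht
  · simp only [h.extend_mul_eq_zero ht hp, mul_zero]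
  · rw [capWeight_eq_mul_inv_max ht, mul_assoc]

end IsBracketing

end PseudoExpectation

section MedianSystem

open MedianVar

variable {k d T : ℕ}

theorem bidegreeLE_certificatePoly (T : ℕ) (Z : Fin k → EuclideanSpace ℝ (Fin d)) (r γ : ℝ) :
    BidegreeLE 2 2 (certificatePoly T Z r γ) := by
  have hconst : ∀ s : ℝ, BidegreeLE 0 0 (C (C s) :
      MvPolynomial (Fin k ⊕ Fin d) (MvPolynomial (MedianVar k d T) ℝ)) :=
    fun s => .C (totalDegree_C s).le
  have hcoeff : ∀ y : MedianVar k d T, BidegreeLE 0 1 (C (X y) :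
      MvPolynomial (Fin k ⊕ Fin d) (MvPolynomial (MedianVar k d T) ℝ)) :=
    fun y => .C (totalDegree_X y).le
  have hvar : ∀ i, BidegreeLE 1 0 (X i :
      MvPolynomial (Fin k ⊕ Fin d) (MvPolynomial (MedianVar k d T) ℝ)) := .X
  have hw : ∀ j : BlockIdx k d, BidegreeLE 1 0 (Sum.elim (fun _ => 1)
      (Sum.elim (fun i => X (Sum.inl i)) fun j => X (Sum.inr j)) j :
        MvPolynomial (Fin k ⊕ Fin d) (MvPolynomial (MedianVar k d T) ℝ)) := by
    rintro (_ | _ | _)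
    exacts [BidegreeLE.one.mono zero_le le_rfl, hvar _, hvar _]
  unfold certificatePoly
  refine .sub ?objective (.add (.add (.add ?shift ?diag) ?trace) ?squares)
  case objective =>
    exact .sub ((hconst _).mono zero_le zero_le)
      (.sum fun i _ => (hvar _).mono one_le_two zero_le)
  case shift =>
    refine .sum fun i _ => ((hcoeff _).mul (hvar _)).mul (m' := 1) (n' := 1) ?_
    exact .sub (.sum fun j _ => .mul (m := 0) (n := 1)
      (.sub ((hconst _).mono le_rfl zero_le) (hcoeff _)) (hvar _))
      ((hconst _).mono zero_le zero_le)
  case diag =>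
    exact .sum fun i _ => ((hcoeff _).mul
      (.sub (BidegreeLE.one.mono zero_le le_rfl) ((hvar _).pow 2))).mono le_rfl one_le_two
  case trace =>
    exact ((hconst _).mul (.sub (BidegreeLE.one.mono zero_le le_rfl)
      (.sum fun j _ => (hvar _).pow 2))).mono le_rfl zero_le
  case squares =>
    exact .sum fun i _ => .pow (m := 1) (n := 1) (.sum fun j _ => (hcoeff _).mul (hw j)) 2

theorem eval_certificatePoly (Z : Fin k → EuclideanSpace ℝ (Fin d)) (r γ : ℝ)
    (b : Fin k → MvPolynomial (MedianVar k d T) ℝ) (v : Fin d → MvPolynomial (MedianVar k d T) ℝ) :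
    eval (Sum.elim b v) (certificatePoly T Z r γ) =
      (C ((k : ℝ) / 10) - ∑ i, b i) -
        (∑ i, pAlpha i * b i * (∑ j, (C (Z i j) - pX j) * v j - C r)
          + ∑ i, pBeta i * (1 - b i ^ 2) + C γ * (1 - ∑ j, v j ^ 2)
          + ∑ i, (∑ j, pSigma i j * (Sum.elim (fun _ => 1) (Sum.elim b v) : BlockIdx k d → _) j)
              ^ 2) := by
  simp [certificatePoly, Fintype.sum_sum_type]

/-- The upper end `2 ^ t * c` of the dyadic level `t ≥ 1` of the multipliers `α_i`; the level `0`
stands for the value `0`. -/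
noncomputable def levelBound (c : ℝ) (t : Fin (T + 1)) : ℝ := if t = 0 then 0 else 2 ^ (t : ℕ) * c

theorem levelBound_zero (c : ℝ) : levelBound c (0 : Fin (T + 1)) = 0 :=
  if_pos rfl

theorem levelBound_succ (c : ℝ) (t : Fin T) : levelBound c t.succ = 2 ^ ((t : ℕ) + 1) * c :=
  if_neg t.succ_ne_zero

namespace PseudoExpectation

variable {Z : Fin k → EuclideanSpace ℝ (Fin d)} {r c' c γ : ℝ}
  {E : PseudoExpectation (MedianVar k d (numLevels c' c)) 8}
  {q : MvPolynomial (MedianVar k d (numLevels c' c)) ℝ}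

namespace Satisfies

theorem alpha_nonneg (hE : E.Satisfies (medianSystem Z r c' c γ)) (i : Fin k) :
    E.SatisfiesIneq (pAlpha i) :=
  hE.2 _ (.inl (.inl (.inl ⟨i, rfl⟩)))

theorem beta_nonneg (hE : E.Satisfies (medianSystem Z r c' c γ)) (i : Fin k) :
    E.SatisfiesIneq (pBeta i) :=
  hE.2 _ (.inl (.inl (.inr ⟨i, rfl⟩)))

theorem alpha_mul_eq_zero (hE : E.Satisfies (medianSystem Z r c' c γ)) (i : Fin k) :
    E.SatisfiesEq (pA i 0 * pAlpha i) :=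
  hE.1 _ (.inl (.inl (.inr ⟨i, rfl⟩)))

theorem isPartition (hE : E.Satisfies (medianSystem Z r c' c γ)) (i : Fin k) :
    E.IsPartition (pA i) where
  totalDegree_le _ := (totalDegree_X _).le
  sq_sub_self t := hE.1 _ (.inl (.inl (.inl (.inr ⟨i, t, rfl⟩))))
  mul_of_ne t t' htt := hE.1 _ (.inr ⟨i, t, t', htt, rfl⟩)
  sum_sub_one := hE.1 _ (.inl (.inr ⟨i, rfl⟩))

theorem isBracketing (hE : E.Satisfies (medianSystem Z r c' c γ)) (hc : 0 < c) (i : Fin k) :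
    E.IsBracketing (pAlpha i) (pA i) (levelBound c) where
  toIsPartition := hE.isPartition i
  totalDegree_alpha_le := (totalDegree_X _).le
  alpha_nonneg := hE.alpha_nonneg i
  bound_nonneg t := by
    unfold levelBound
    split_ifs <;> positivity
  mul_of_bound_eq_zero t ht := by
    cases t using Fin.cases with
    | zero => exact hE.alpha_mul_eq_zero i
    | succ t =>
      rw [levelBound_succ] at ht
      exact absurd ht (by positivity)
  lower_bound t := by
    cases t using Fin.cases with
    | zero => simpa [levelBound_zero] using (hE.alpha_mul_eq_zero i).satisfiesIneq
    | succ t =>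
      rw [levelBound_succ, pow_succ, mul_right_comm, mul_div_cancel_right₀ _ two_ne_zero]
      exact hE.2 _ (.inl (.inr ⟨i, t, rfl⟩))
  upper_bound t := by
    cases t using Fin.cases with
    | zero => simpa [levelBound_zero] using (hE.alpha_mul_eq_zero i).neg.satisfiesIneq
    | succ t =>
      rw [levelBound_succ]
      exact hE.2 _ (.inr ⟨i, t, rfl⟩)

theorem certificate_le (hE : E.Satisfies (medianSystem Z r c' c γ))
    {b : Fin k → MvPolynomial (MedianVar k d (numLevels c' c)) ℝ}
    {v : Fin d → MvPolynomial (MedianVar k d (numLevels c' c)) ℝ}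
    (hb : ∀ i, (b i).totalDegree ≤ 1) (hv : ∀ j, (v j).totalDegree ≤ 1)
    (hq : q.totalDegree ≤ 1) :
    ∑ i, E.extend (q ^ 2 * (pAlpha i * b i * (∑ j, (C (Z i j) - pX j) * v j - C r)))
        + ∑ i, E.extend (q ^ 2 * (pBeta i * (1 - b i ^ 2)))
        + γ * E.extend (q ^ 2 * (1 - ∑ j, v j ^ 2))
      ≤ (k : ℝ) / 10 * E.extend (q ^ 2) - ∑ i, E.extend (q ^ 2 * b i) := by
  let w : BlockIdx k d → MvPolynomial (MedianVar k d (numLevels c' c)) ℝ :=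
    Sum.elim (fun _ => 1) (Sum.elim b v)
  have hw : ∀ j, (w j).totalDegree ≤ 1 := by
    rintro (_ | i | j)
    exacts [by simp [w], hb i, hv j]
  have hsquares : 0 ≤ ∑ i, E.extend ((q * ∑ j, pSigma i j * w j) ^ 2) :=
    Finset.sum_nonneg fun i _ => E.extend_sq_nonneg <| by
      have hrow : (∑ j, pSigma i j * w j).totalDegree ≤ 2 := totalDegree_finsetSum_le fun j _ =>
        totalDegree_mul_le_of_le (totalDegree_X _).le (hw j)
      have := totalDegree_mul_le_of_le hq hrow
      omega
  have hzero : E.extend (q ^ 2 * eval (Sum.elim b v) (certificatePoly _ Z r γ)) = 0 :=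
    extend_mul_eval_eq_zero (bidegreeLE_certificatePoly _ Z r γ)
      (fun e => hE.1 _ (.inl (.inl (.inl (.inl ⟨e, rfl⟩))))) (Sum.forall.2 ⟨hb, hv⟩)
      (by have := totalDegree_pow_le_of_le hq 2; omega)
  have hexpand : q ^ 2 * eval (Sum.elim b v) (certificatePoly _ Z r γ) =
      C ((k : ℝ) / 10) * q ^ 2 - ∑ i, q ^ 2 * b i -
        (∑ i, q ^ 2 * (pAlpha i * b i * (∑ j, (C (Z i j) - pX j) * v j - C r))
          + ∑ i, q ^ 2 * (pBeta i * (1 - b i ^ 2)) + C γ * (q ^ 2 * (1 - ∑ j, v j ^ 2))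
          + ∑ i, (q * ∑ j, pSigma i j * w j) ^ 2) := by
    rw [eval_certificatePoly]
    simp only [w, mul_pow, ← Finset.mul_sum]
    ring
  rw [hexpand] at hzero
  simp only [map_sub, map_add, map_sum, E.extend_C_mul] at hzero
  linarith

end Satisfies
end PseudoExpectation
end MedianSystem

section DualMoments

variable {k d n : ℕ} {V : Type} {Z : Fin k → EuclideanSpace ℝ (Fin d)}
  {x : EuclideanSpace ℝ (Fin d)} {r p γ : ℝ} {α β : Fin k → ℝ}

theorem CentralityDual.extend_le (h : CentralityDual Z x r p α β γ) (E : PseudoExpectation V n)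
    {q : MvPolynomial V ℝ} {b : Fin k → MvPolynomial V ℝ} {v : Fin d → MvPolynomial V ℝ}
    (hq : 2 * q.totalDegree ≤ n) (hb : ∀ i, 2 * (q * b i).totalDegree ≤ n)
    (hv : ∀ j, 2 * (q * v j).totalDegree ≤ n) :
    ∑ i, α i * E.extend (q ^ 2 * (∑ j, C (Z i j - x j) * v j - C r) * b i)
        + ∑ i, β i * (E.extend (q ^ 2) - E.extend (q ^ 2 * b i ^ 2))
        + γ * E.extend (q ^ 2 * (1 - ∑ j, v j ^ 2))
      ≤ p * k * E.extend (q ^ 2) - ∑ i, E.extend (q ^ 2 * b i) := by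
  let w : BlockIdx k d → MvPolynomial V ℝ := Sum.elim (fun _ => 1) (Sum.elim b v)
  have hw : ∀ i, 2 * (q * w i).totalDegree ≤ n := by
    rintro (_ | i | j)
    exacts [by simpa [w] using hq, hb i, hv j]
  have hlag := h.lagrangian_le _ (E.posSemidef_moments hw)
  simp only [w, Matrix.of_apply, Sum.elim_inl, Sum.elim_inr, one_mul, mul_one, one_pow,
    ← pow_two] at hlag
  have hshift : ∀ i, E.extend (q ^ 2 * (∑ j, C (Z i j - x j) * v j - C r) * b i) =
      ∑ j, (Z i j - x j) * E.extend (q ^ 2 * (b i * v j)) - r * E.extend (q ^ 2 * b i) :=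
    fun i => by
      have hterm : q ^ 2 * (∑ j, C (Z i j - x j) * v j - C r) * b i =
          ∑ j, C (Z i j - x j) * (q ^ 2 * (b i * v j)) - C r * (q ^ 2 * b i) := by
        rw [mul_sub, sub_mul, Finset.mul_sum, Finset.sum_mul]
        exact congrArg₂ _ (Finset.sum_congr rfl fun j _ => by ring) (by ring)
      rw [hterm, map_sub, map_sum]
      simp only [E.extend_C_mul]
  simp only [hshift]
  simpa only [mul_sub, mul_one, Finset.mul_sum, map_sub, map_sum] using hlag

end DualMoments

section MedianBound

open MedianVar

variable {k d : ℕ} {Z : Fin k → EuclideanSpace ℝ (Fin d)} {μ : EuclideanSpace ℝ (Fin d)}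
  {r p c' c γ γ' : ℝ} {α' β' : Fin k → ℝ}
  {E : PseudoExpectation (MedianVar k d (numLevels c' c)) 8}
  {q : MvPolynomial (MedianVar k d (numLevels c' c)) ℝ}

theorem PseudoExpectation.sqDist_eq_extend {T : ℕ} (E : PseudoExpectation (MedianVar k d T) 8)
    (μ : EuclideanSpace ℝ (Fin d)) : E.sqDist μ = E.extend (sqDistPoly μ) :=
  (E.extend_eq _).symm

theorem PseudoExpectation.sqDist_nonneg {T : ℕ} (E : PseudoExpectation (MedianVar k d T) 8)
    (μ : EuclideanSpace ℝ (Fin d)) : 0 ≤ E.sqDist μ := by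
  rw [E.sqDist_eq_extend, sqDistPoly, map_sum]
  exact Finset.sum_nonneg fun j _ => E.extend_sq_nonneg
    ((Nat.mul_le_mul_left 2 ((totalDegree_sub_C_le _ _).trans_eq (totalDegree_X _))).trans
      (by norm_num))

namespace PseudoExpectation.Satisfies

theorem gamma_mul_le (hE : E.Satisfies (medianSystem Z r c' c γ)) (t : ℝ) :
    γ * (1 - d * t ^ 2) ≤ (k : ℝ) / 10 := by
  have h := hE.certificate_le (b := fun _ => 0) (v := fun _ => C t) (q := 1) (by simp) (by simp)
    (by simp)
  have hnorm : E.extend (1 - ∑ _j : Fin d, C t ^ 2) = 1 - d * t ^ 2 := by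
    rw [Finset.sum_const, Finset.card_univ, Fintype.card_fin, nsmul_eq_mul, map_sub, E.extend_one,
      ← map_natCast C, E.extend_C_mul, ← C_pow, ← mul_one (C _), E.extend_C_mul, E.extend_one,
      mul_one]
  have hbeta : ∀ i, 0 ≤ E.extend (pBeta i) := fun i => by
    simpa using (hE.beta_nonneg i).extend_mul_sq_nonneg (q := 1) (by simp)
  simp only [one_pow, one_mul, mul_zero, zero_mul, map_zero, Finset.sum_const_zero, zero_add,
    ne_eq, OfNat.ofNat_ne_zero, not_false_eq_true, zero_pow, sub_zero, mul_one, hnorm,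
    E.extend_one] at h
  linarith [Finset.sum_nonneg fun i (_ : i ∈ Finset.univ) => hbeta i]

theorem gamma_le (hE : E.Satisfies (medianSystem Z r c' c γ)) : γ ≤ (k : ℝ) / 10 := by
  simpa using hE.gamma_mul_le 0

theorem gamma_nonneg (hE : E.Satisfies (medianSystem Z r c' c γ)) (hd : 0 < d) : 0 ≤ γ := by
  have h : d * -γ ≤ 0 := nonpos_of_forall_mul_le (u := k / 10 - γ) fun t ht => by
    have := hE.gamma_mul_le √t
    rw [Real.sq_sqrt ht] at this
    linarith
  exact neg_nonpos.1 (nonpos_of_mul_nonpos_right h (Nat.cast_pos.2 hd))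

theorem sum_extend_alpha_le (hE : E.Satisfies (medianSystem Z r c' c γ)) :
    r * ∑ i, E.extend (pAlpha i) ≤ 11 / 10 * k - γ := by
  have h := hE.certificate_le (b := fun _ => C (-1)) (v := fun _ => 0) (q := 1) (by simp)
    (by simp) (by simp)
  have halpha : ∀ i : Fin k, (1 : MvPolynomial (MedianVar k d (numLevels c' c)) ℝ) ^ 2 *
      (pAlpha i * C (-1) * (∑ j, (C (Z i j) - pX j) * 0 - C r)) = C r * pAlpha i := fun i => by
    simp [mul_comm]
  simp only [halpha, E.extend_C_mul, ← Finset.mul_sum] at h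
  simp only [one_pow, one_mul, mul_one, zero_pow two_ne_zero, sub_zero, sub_self, mul_zero,
    map_zero, E.extend_one, C_1, neg_sq, Finset.sum_const_zero, map_neg,
    Finset.sum_neg_distrib, Finset.sum_const, Finset.card_univ, Fintype.card_fin,
    nsmul_eq_mul] at h
  linarith

theorem extend_shift_capPoly_add_ratioPoly (hE : E.Satisfies (medianSystem Z r c' c γ))
    (hc : 0 < c) {w : Fin d → MvPolynomial (MedianVar k d (numLevels c' c)) ℝ}
    (hw : ∀ j, (w j).totalDegree ≤ 1) (hq : q.totalDegree ≤ 1) (μ : EuclideanSpace ℝ (Fin d))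
    (s : ℝ) (i : Fin k) :
    E.extend (q ^ 2 * (pAlpha i * capPoly (pA i) (levelBound c) s *
          (∑ j, (C (Z i j) - pX j) * -w j - C r)))
        + s * E.extend (q ^ 2 * (∑ j, C (Z i j - μ j) * w j - C r) *
            ratioPoly (pAlpha i) (pA i) (levelBound c) s)
      = E.extend (q ^ 2 * (∑ j, (pX j - C (μ j)) * w j - C (2 * r)) *
          (pAlpha i * capPoly (pA i) (levelBound c) s)) := by
  have hshift : ∑ j, (pX j - C (μ j)) * w j =
      ∑ j, (C (Z i j) - pX j) * -w j + ∑ j, C (Z i j - μ j) * w j := by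
    rw [← Finset.sum_add_distrib]
    exact Finset.sum_congr rfl fun j _ => by
      rw [C_sub]
      ring
  have hdeg : (q ^ 2 * (∑ j, C (Z i j - μ j) * w j - C r)).totalDegree ≤ 2 + 1 :=
    totalDegree_mul_le_of_le (totalDegree_pow_le_of_le hq 2)
      (totalDegree_sub_le_of_le (totalDegree_finsetSum_le fun j _ => by
        rw [C_mul']
        exact (totalDegree_smul_le _ _).trans (hw j)) (by simp))
  rw [← (hE.isBracketing hc i).extend_mul_capPoly_eq _ (by omega), ← map_add, hshift, two_mul,
    C_add]
  exact congrArg _ (by ring)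

theorem sum_extend_alpha_mul_capPoly_le (hE : E.Satisfies (medianSystem Z r c' c γ)) (hc : 0 < c)
    (hμ : CentralityDual Z μ r p α' β' γ')
    {w : Fin d → MvPolynomial (MedianVar k d (numLevels c' c)) ℝ}
    (hw : ∀ j, (w j).totalDegree ≤ 1) (hq : q.totalDegree ≤ 1) :
    ∑ i, E.extend (q ^ 2 * (∑ j, (pX j - C (μ j)) * w j - C (2 * r)) *
          (pAlpha i * capPoly (pA i) (levelBound c) (α' i)))
        + (γ + γ') * E.extend (q ^ 2 * (1 - ∑ j, w j ^ 2))
      ≤ (p - 2 / 5) * k * E.extend (q ^ 2) := by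
  have hbr := hE.isBracketing hc
  set cap := fun i => capPoly (pA i) (levelBound c) (α' i)
  set ratio := fun i => ratioPoly (pAlpha i) (pA i) (levelBound c) (α' i)
  have hratio : ∀ i, (ratio i).totalDegree ≤ 2 := fun i => (hbr i).totalDegree_ratioPoly_le _
  have hcert := hE.certificate_le (b := cap) (v := fun j => -w j)
    (fun i => (hbr i).totalDegree_capPoly_le _) (fun j => by simpa using hw j) hq
  have hdual := hμ.extend_le E (b := ratio) (v := w) (q := q) (by omega)
    (fun i => by have := totalDegree_mul_le_of_le hq (hratio i); omega)
    (fun j => by have := totalDegree_mul_le_of_le hq (hw j); omega)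
  have hweights : (k : ℝ) * (1 / 2 * E.extend (q ^ 2)) ≤
      ∑ i, E.extend (q ^ 2 * cap i) + ∑ i, E.extend (q ^ 2 * ratio i) := by
    simpa [Finset.sum_add_distrib] using Finset.sum_le_sum fun i (_ : i ∈ Finset.univ) =>
      (hbr i).half_le_extend_capPoly_add_ratioPoly (hμ.alpha_nonneg i) (q := q) (by omega)
  have hbeta : 0 ≤ ∑ i, E.extend (q ^ 2 * (pBeta i * (1 - cap i ^ 2))) :=
    Finset.sum_nonneg fun i _ => by
      rw [← mul_assoc, mul_sub, mul_one, map_sub, sub_nonneg]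
      exact (hbr i).extend_sq_mul_mul_capPoly_sq_le (hμ.alpha_nonneg i) (hE.beta_nonneg i)
        (by rw [totalDegree_X]; omega)
  have hbeta' : 0 ≤ ∑ i, β' i * (E.extend (q ^ 2) - E.extend (q ^ 2 * ratio i ^ 2)) :=
    Finset.sum_nonneg fun i _ => mul_nonneg (hμ.beta_nonneg i)
      (sub_nonneg.2 ((hbr i).extend_sq_mul_ratioPoly_sq_le _ (by omega)))
  rw [Finset.sum_congr rfl fun i _ =>
    (hE.extend_shift_capPoly_add_ratioPoly hc hw hq μ (α' i) i).symm, Finset.sum_add_distrib]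
  simp only [neg_sq] at hcert
  linarith

theorem extend_sqDistPoly_le (hE : E.Satisfies (medianSystem Z r c' c γ)) (hc : 0 < c)
    (hμ : CentralityDual Z μ r p α' β' γ') :
    (2 / 5 - p) * k * E.extend (sqDistPoly μ) ≤ 2 * r * ∑ i,
      E.extend (sqDistPoly μ * (pAlpha i * capPoly (pA i) (levelBound c) (α' i))) := by
  simp only [sqDistPoly, Finset.sum_mul, map_sum]
  rw [Finset.sum_comm, Finset.mul_sum, Finset.mul_sum]
  refine Finset.sum_le_sum fun j _ => ?_
  have hdeg : (pX j - C (μ j) : MvPolynomial (MedianVar k d (numLevels c' c)) ℝ).totalDegree ≤ 1 :=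
    (totalDegree_sub_C_le _ _).trans_eq (totalDegree_X _)
  have h := hE.sum_extend_alpha_mul_capPoly_le hc hμ (w := 0) (by simp) hdeg
  have hgamma := mul_nonneg (add_nonneg (hE.gamma_nonneg j.pos) hμ.gamma_nonneg)
    (E.extend_sq_nonneg (q := pX j - C (μ j)) (by omega))
  have hterm : ∀ P Q : MvPolynomial (MedianVar k d (numLevels c' c)) ℝ,
      E.extend (P * (0 - C (2 * r)) * Q) = -(2 * r) * E.extend (P * Q) := fun P Q => by
    rw [← E.extend_C_mul, C_neg]
    exact congrArg _ (by ring)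
  simp only [Pi.zero_apply, mul_zero, Finset.sum_const_zero, hterm, ← Finset.mul_sum,
    zero_pow two_ne_zero, sub_zero, mul_one] at h
  linarith

theorem mul_sum_extend_sqDistPoly_le (hE : E.Satisfies (medianSystem Z r c' c γ)) (hc : 0 < c)
    (hr : 0 ≤ r) (hμ : CentralityDual Z μ r p α' β' γ') (s : ℝ) :
    s * ∑ i, E.extend (sqDistPoly μ * (pAlpha i * capPoly (pA i) (levelBound c) (α' i)))
        + (γ + γ') * (1 - s ^ 2 * E.extend (sqDistPoly μ))
      ≤ (p - 2 / 5) * k + 2 * (11 / 10 * k - γ) := by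
  have hdeg : ∀ j, (C s * (pX j - C (μ j)) :
      MvPolynomial (MedianVar k d (numLevels c' c)) ℝ).totalDegree ≤ 1 := fun j => by
    rw [C_mul']
    exact (totalDegree_smul_le _ _).trans
      ((totalDegree_sub_C_le _ _).trans_eq (totalDegree_X _))
  have h := hE.sum_extend_alpha_mul_capPoly_le hc hμ (q := 1) hdeg (by simp)
  have hcap : r * ∑ i, E.extend (pAlpha i * capPoly (pA i) (levelBound c) (α' i)) ≤
      11 / 10 * k - γ :=
    (mul_le_mul_of_nonneg_left (Finset.sum_le_sum fun i _ => by
      simpa only [one_pow, one_mul] using (hE.isBracketing hc i).extend_sq_mul_mul_capPoly_le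
        (s := α' i) (q := 1) (hE.alpha_nonneg i) (by simp)) hr).trans hE.sum_extend_alpha_le
  have hnorm : ∀ j, (pX j - C (μ j)) * (C s * (pX j - C (μ j))) =
      (C s * (pX j - C (μ j)) ^ 2 : MvPolynomial (MedianVar k d (numLevels c' c)) ℝ) :=
    fun j => by ring
  simp only [hnorm, mul_pow, ← Finset.mul_sum, one_pow, one_mul, ← C_pow] at h
  simp only [sub_mul, mul_assoc, map_sub, E.extend_C_mul, E.extend_one, mul_one,
    Finset.sum_sub_distrib, ← Finset.mul_sum] at h
  simp only [sqDistPoly]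
  linarith

theorem sqDist_le_of_dual (hE : E.Satisfies (medianSystem Z r c' c γ)) (hc : 0 < c) (hd : 0 < d)
    (hk : 0 < k) (hr : 0 < r) (hp : p < 2 / 5) (hμ : CentralityDual Z μ r p α' β' γ') :
    E.sqDist μ ≤ 11 / 5 / (2 / 5 - p) ^ 3 * r ^ 2 := by
  have hgap := hE.extend_sqDistPoly_le hc hμ
  have hmain := hE.mul_sum_extend_sqDistPoly_le hc hr.le hμ ((2 / 5 - p) / r)
  have hρ := E.sqDist_nonneg μ
  rw [← E.sqDist_eq_extend] at hgap hmain
  set ρ := E.sqDist μ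
  set s := (2 / 5 - p) / r
  set D := ∑ i, E.extend (sqDistPoly μ * (pAlpha i * capPoly (pA i) (levelBound c) (α' i)))
  have hp' : 0 < 2 / 5 - p := sub_pos.2 hp
  have hk' : (0 : ℝ) < k := Nat.cast_pos.2 hk
  have hsr : s * r = 2 / 5 - p := div_mul_cancel₀ _ hr.ne'
  have hD : s ^ 2 * k * ρ ≤ 2 * (s * D) := by
    refine le_of_mul_le_mul_left ?_ hr
    calc r * (s ^ 2 * k * ρ) = s * ((2 / 5 - p) * k * ρ) := by rw [← hsr]; ring
      _ ≤ s * (2 * r * D) := mul_le_mul_of_nonneg_left hgap (by positivity)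
      _ = r * (2 * (s * D)) := by ring
  have hgamma : γ + γ' ≤ (1 / 10 + p) * k := by linarith [hE.gamma_le, hμ.gamma_le]
  have hgamma_mul := mul_le_mul_of_nonneg_right hgamma (mul_nonneg (sq_nonneg s) hρ)
  have hbound : k * ((2 / 5 - p) * (s ^ 2 * ρ)) ≤ k * (11 / 5) := by
    linarith [hE.gamma_nonneg hd, hμ.gamma_nonneg, mul_pos hp' hk']
  rw [div_mul_eq_mul_div, le_div_iff₀ (by positivity)]
  calc ρ * (2 / 5 - p) ^ 3 = (2 / 5 - p) * (s ^ 2 * ρ) * r ^ 2 := by rw [← hsr]; ring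
    _ ≤ 11 / 5 * r ^ 2 :=
      mul_le_mul_of_nonneg_right (le_of_mul_le_mul_left hbound hk') (sq_nonneg r)

end PseudoExpectation.Satisfies

end MedianBound

theorem mainTheorem5_general {d k : ℕ} (hk : 0 < k) {Z : Fin k → EuclideanSpace ℝ (Fin d)}
    {μ : EuclideanSpace ℝ (Fin d)} {r p : ℝ} (hr : 0 < r) (hp : p < 2 / 5)
    (hμ : CertifiablyCentral Z r p μ) {c C γ : ℝ} (hc : 0 < c)
    {E : PseudoExpectation (MedianVar k d (numLevels C c)) 8}
    (hE : E.Satisfies (medianSystem Z r C c γ)) :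
    E.sqDist μ ≤ 11 / 5 / (2 / 5 - p) ^ 3 * r ^ 2 := by
  rcases d.eq_zero_or_pos with rfl | hd
  · have hzero : E.sqDist μ = 0 := by simp [E.sqDist_eq_extend, sqDistPoly]
    have := sub_pos.2 hp
    rw [hzero]
    positivity
  · obtain ⟨α, β, γ', hdual⟩ := hμ.exists_dual hr
    exact hE.sqDist_le_of_dual hc hd hk hr hp hdual

theorem mainTheorem5 :
    ∃ K : ℝ, ∀ (d k : ℕ), 0 < k →
      ∀ (Z : Fin k → EuclideanSpace ℝ (Fin d)) (μ : EuclideanSpace ℝ (Fin d)) (r : ℝ), 0 < r →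
        CertifiablyCentral Z r (1 / 10) μ →
        ∀ (c C γ : ℝ), 0 < c → 0 < C →
          ∀ E : PseudoExpectation (MedianVar k d (numLevels C c)) 8,
            E.Satisfies (medianSystem Z r C c γ) →
              E.sqDist μ ≤ K * r ^ 2 :=
  ⟨11 / 5 / (2 / 5 - 1 / 10) ^ 3, fun _ _ hk _ _ _ hr hμ _ _ _ hc _ _ hE =>
    mainTheorem5_general hk hr (by norm_num) hμ hc hE⟩
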